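/- Let $(W,S)$ be a Coxeter system. For $I\subseteq S$ let $W_I$ be the subgroup of $W$ generated by $I$. A nonempty subset $I\subseteq S$ is called connected if $W_I$ is finite and $I$ cannot be written as a disjoint union $I=J\sqcup K$ of nonempty sets with $W_I=W_J\times W_K$ (internal direct product). Let $\mathcal F(S)$ be the family of connected subsets of $S$, and for $I\in\mathcal F(S)$ let $w_I$ be the longest element of $W_I$. If $I,J\in\mathcal F(S)$ satisfy $I\subseteq J$ or $W_{I\cup J}=W_I\times W_J$, then $w_J(I):=w_JIw_J^{-1}$ is again a member of $\mathcal F(S)$. The generalized cactus group $C_W$ is the group generated by $\{\gamma_I : I\in\mathcal F(S)\}$ subject to the relations $$\gamma_I^2=1,\qquad \gamma_I\gamma_J=\gamma_J\gamma_{w_J(I)}\ \text{ if } I\subseteq J \text{ or } W_{I\cup J}=W_I\times W_J .$$ Let $\mathbb S=\{wW_Iw^{-1} : w\in W,\ I\in\mathcal F(S)\}$, and let $\mathbb W$ be the right-angled Coxeter group with generators $\tau_{P}$ ($P\in\mathbb S$) and the Coxeter matrix $$m(P,Q)=\begin{cases}1,&P=Q,\\ 2,&P\subsetneq Q\text{ or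 }Q\subsetneq P,\\ 2,&P\ne Q,\ P\cap Q=\{1\}\text{ and }Q\text{ centralizes }P,\\ \infty,&\text{otherwise.}\end{cases}$$ Let $\operatorname{Aut}(\mathbb W,\mathbb S)$ be the group of the automorphisms of $\mathbb W$ that map the set $\{\tau_P : P\in\mathbb S\}$ onto itself. Let $g\colon W\to\operatorname{Aut}(\mathbb W,\mathbb S)$, $w\mapsto g_w$, be the homomorphism with $g_w(\tau_P)=\tau_{wPw^{-1}}$, and put $g_I=g_{w_I}$ for $I\in\mathcal F(S)$. Then there is a homomorphism $g_W\colon C_W\to W$ with $g_W(\gamma_I)=w_I$ for all $I\in\mathcal F(S)$; let $PC_W=\ker g_W$. There is an injective homomorphism $$h\colon C_W\hookrightarrow \mathbb W\rtimes\operatorname{Aut}(\mathbb W,\mathbb S),\qquad h(\gamma_I)=\tau_{W_I}\cdot g_I\quad (I\in\mathcal F(S)).$$ The composite of $h$ with the projection $\mathbb W\rtimes\operatorname{Aut}(\mathbb W,\mathbb S)\to\operatorname{Aut}(\mathbb W,\mathbb S)$ equals $g\circ g_W$, and $h$ restricts to an injective homomorphism $PC_W\hookrightarrow\mathbb W$.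 -/

import Mathlib

noncomputable section

namespace GenCactus

universe u v

section Parabolic

variable {B : Type u} {W : Type v} [Group W] {M : CoxeterMatrix B} (cs : CoxeterSystem M W)

/-- The standard parabolic subgroup `W_I` generated by the simple reflections indexed by `I`. -/
def parabolic (I : Set B) : Subgroup W := Subgroup.closure (cs.simple '' I)

/-- `L` is the internal direct product of its subgroups `H` and `K`. -/
def IsDirectProduct (L H K : Subgroup W) : Prop :=
  L = H ⊔ K ∧ H ⊓ K = ⊥ ∧ ∀ h ∈ H, ∀ k ∈ K, Commute h k

/-- `I` is connected: it is nonempty, `W_I` is finite, and `I` is not the disjoint union of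
nonempty sets `J`, `K` with `W_I = W_J × W_K`. -/
def IsConnectedSubset (I : Set B) : Prop :=
  I.Nonempty ∧ (parabolic cs I : Set W).Finite ∧
    ¬ ∃ J K : Set B, J.Nonempty ∧ K.Nonempty ∧ Disjoint J K ∧ I = J ∪ K ∧
      IsDirectProduct (parabolic cs I) (parabolic cs J) (parabolic cs K)

/-- The family `F(S)` of connected subsets. -/
def ConnectedFamily : Type u := {I : Set B // IsConnectedSubset cs I}

theorem exists_longest (I : ConnectedFamily cs) :
    ∃ w ∈ parabolic cs I.1, ∀ v ∈ parabolic cs I.1, cs.length v ≤ cs.length w := by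
  obtain ⟨w, hw, h⟩ := Set.exists_max_image (parabolic cs I.1 : Set W) cs.length I.2.2.1
    ⟨1, (parabolic cs I.1).one_mem⟩
  exact ⟨w, hw, h⟩

/-- The longest element `w_I` of the finite group `W_I`. -/
def longest (I : ConnectedFamily cs) : W := (exists_longest cs I).choose

theorem longest_mem (I : ConnectedFamily cs) : longest cs I ∈ parabolic cs I.1 :=
  (exists_longest cs I).choose_spec.1

theorem length_le_longest (I : ConnectedFamily cs) {w : W} (hw : w ∈ parabolic cs I.1) :
    cs.length w ≤ cs.length (longest cs I) :=
  (exists_longest cs I).choose_spec.2 w hw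

/-- `K = w_J(I)`, that is, `K` and `w_J I w_J⁻¹` are the same set of simple reflections. -/
def IsConjBy (J I K : ConnectedFamily cs) : Prop :=
  cs.simple '' K.1 = (fun x => longest cs J * x * (longest cs J)⁻¹) '' (cs.simple '' I.1)

/-- The side condition of the cactus relations: `I ⊆ J` or `W_{I ∪ J} = W_I × W_J`. -/
def Compatible (I J : ConnectedFamily cs) : Prop :=
  I.1 ⊆ J.1 ∨
    IsDirectProduct (parabolic cs (I.1 ∪ J.1)) (parabolic cs I.1) (parabolic cs J.1)

/-- The relators of the cactus group: `γ_I ^ 2`, and, whenever `I ⊆ J` or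
`W_{I ∪ J} = W_I × W_J`, the relator expressing `γ_I γ_J = γ_J γ_K`, where `K = w_J(I)`. -/
def cactusRelators : Set (FreeGroup (ConnectedFamily cs)) :=
  {r | ∃ I, r = FreeGroup.of I ^ 2} ∪
  {r | ∃ I J K, Compatible cs I J ∧ IsConjBy cs J I K ∧
    r = (FreeGroup.of I * FreeGroup.of J) * (FreeGroup.of J * FreeGroup.of K)⁻¹}

/-- The generalized cactus group `C_W`. -/
abbrev CactusGroup : Type u := PresentedGroup (cactusRelators cs)

/-- The generator `γ_I` of `C_W`. -/
def gam (I : ConnectedFamily cs) : CactusGroup cs := PresentedGroup.of I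

/-- The set `𝕊` of the subgroups `w W_I w⁻¹`, for `w ∈ W` and `I ∈ F(S)`. -/
def ParabolicConj : Type v :=
  {P : Subgroup W // ∃ (w : W) (I : ConnectedFamily cs),
    P = (parabolic cs I.1).map (MulAut.conj w).toMonoidHom}

/-- `W_I` as an element of `𝕊`. -/
def ParabolicConj.std (I : ConnectedFamily cs) : ParabolicConj cs :=
  ⟨parabolic cs I.1, 1, I, by ext x; simp⟩

open Classical in
/-- The right-angled Coxeter matrix on `𝕊`; the entry `0` stands for `∞`. -/
def bigMatrix : CoxeterMatrix (ParabolicConj cs) where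
  M := Matrix.of fun P Q =>
    if P = Q then 1
    else if P.1 ≤ Q.1 ∨ Q.1 ≤ P.1 then 2
    else if P.1 ⊓ Q.1 = ⊥ ∧ Q.1 ≤ Subgroup.centralizer (P.1 : Set W) then 2
    else 0
  isSymm := by
    ext P Q
    simp only [Matrix.transpose_apply, Matrix.of_apply, eq_comm (a := Q) (b := P),
      or_comm (a := Q.1 ≤ P.1), inf_comm Q.1 P.1,
      Subgroup.le_centralizer_iff (H := P.1) (K := Q.1)]
  diagonal P := by simp
  off_diagonal P Q h := by
    simp only [Matrix.of_apply, if_neg h]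
    split_ifs <;> decide

/-- The right-angled Coxeter group `𝕎`. -/
abbrev BigGroup : Type v := (bigMatrix cs).Group

/-- The generator `τ_P` of `𝕎`. -/
def tau (P : ParabolicConj cs) : BigGroup cs := (bigMatrix cs).simple P

/-- The group `Aut(𝕎, 𝕊)` of the automorphisms of `𝕎` that map the set of the generators `τ_P`
onto itself. -/
def DiagramAut : Subgroup (MulAut (BigGroup cs)) where
  carrier := {φ | φ '' Set.range (tau cs) = Set.range (tau cs)}
  one_mem' := by simp
  mul_mem' := by
    intro a b ha hb
    simp only [Set.mem_ofPred_eq] at *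
    rw [MulAut.coe_mul, Set.image_comp, hb, ha]
  inv_mem' := by
    intro a ha
    simp only [Set.mem_ofPred_eq] at *
    conv_lhs => rw [← ha]
    rw [← Set.image_comp, ← MulAut.coe_mul, inv_mul_cancel, MulAut.coe_one, Set.image_id]

/-- Conjugation of the members of `𝕊` by an element of `W`. -/
def ParabolicConj.conj (w : W) (P : ParabolicConj cs) : ParabolicConj cs :=
  ⟨P.1.map (MulAut.conj w).toMonoidHom, by
    obtain ⟨P, x, I, rfl⟩ := P
    refine ⟨w * x, I, ?_⟩
    rw [Subgroup.map_map, map_mul]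
    rfl⟩

theorem ParabolicConj.conj_one (P : ParabolicConj cs) : conj cs 1 P = P := by
  apply Subtype.ext
  ext x
  simp [conj]

theorem ParabolicConj.conj_mul (w x : W) (P : ParabolicConj cs) :
    conj cs (w * x) P = conj cs w (conj cs x P) := by
  apply Subtype.ext
  simp only [conj, Subgroup.map_map, map_mul]
  rfl

theorem ParabolicConj.conj_injective (w : W) : Function.Injective (conj cs w) := by
  intro P Q h
  have := congrArg (conj cs w⁻¹) h
  rwa [← conj_mul, ← conj_mul, inv_mul_cancel, conj_one, conj_one] at this

theorem bigMatrix_conj (w : W) (P Q : ParabolicConj cs) :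
    bigMatrix cs (ParabolicConj.conj cs w P) (ParabolicConj.conj cs w Q) = bigMatrix cs P Q := by
  have hinj : Function.Injective (MulAut.conj w).toMonoidHom := (MulAut.conj w).injective
  have hle (H K : Subgroup W) : H.map (MulAut.conj w).toMonoidHom ≤
      K.map (MulAut.conj w).toMonoidHom ↔ H ≤ K := Subgroup.map_le_map_iff_of_injective hinj
  have hinf (H K : Subgroup W) : H.map (MulAut.conj w).toMonoidHom ⊓
      K.map (MulAut.conj w).toMonoidHom = ⊥ ↔ H ⊓ K = ⊥ := by
    rw [← Subgroup.map_inf _ _ _ hinj, Subgroup.map_eq_bot_iff_of_injective _ hinj]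
  have hcent (H K : Subgroup W) : H.map (MulAut.conj w).toMonoidHom ≤
      Subgroup.centralizer (K.map (MulAut.conj w).toMonoidHom : Set W) ↔
      H ≤ Subgroup.centralizer (K : Set W) := by
    constructor
    · intro h x hx y hy
      have := h (Subgroup.mem_map_of_mem _ hx) _ (Subgroup.mem_map_of_mem _ hy)
      rw [← map_mul, ← map_mul] at this
      exact hinj this
    · rintro h _ ⟨x, hx, rfl⟩ _ ⟨y, hy, rfl⟩
      rw [← map_mul, ← map_mul, h hx y hy]
  have heq : ParabolicConj.conj cs w P = ParabolicConj.conj cs w Q ↔ P = Q :=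
    (ParabolicConj.conj_injective cs w).eq_iff
  classical
  exact if_congr heq rfl (if_congr (or_congr (hle _ _) (hle _ _)) rfl
    (if_congr (and_congr (hinf _ _) (hcent _ _)) rfl rfl))

/-- The endomorphism of `𝕎` with `τ_P ↦ τ_{w P w⁻¹}`. -/
def conjEnd (w : W) : BigGroup cs →* BigGroup cs :=
  (bigMatrix cs).toCoxeterSystem.lift
    ⟨fun P => tau cs (ParabolicConj.conj cs w P), fun P Q => by
      rw [← bigMatrix_conj cs w P Q]
      exact (bigMatrix cs).toCoxeterSystem.simple_mul_simple_pow _ _⟩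

theorem conjEnd_tau (w : W) (P : ParabolicConj cs) :
    conjEnd cs w (tau cs P) = tau cs (ParabolicConj.conj cs w P) :=
  (bigMatrix cs).toCoxeterSystem.lift_apply_simple _ _

theorem conjEnd_one : conjEnd cs 1 = MonoidHom.id _ :=
  (bigMatrix cs).toCoxeterSystem.ext_simple fun P =>
    (conjEnd_tau cs 1 P).trans (congrArg (tau cs) (ParabolicConj.conj_one cs P))

theorem conjEnd_mul (w x : W) : conjEnd cs (w * x) = (conjEnd cs w).comp (conjEnd cs x) :=
  (bigMatrix cs).toCoxeterSystem.ext_simple fun P => by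
    change conjEnd cs (w * x) (tau cs P) = conjEnd cs w (conjEnd cs x (tau cs P))
    rw [conjEnd_tau, conjEnd_tau, conjEnd_tau, ParabolicConj.conj_mul]

/-- The automorphism of `𝕎` with `τ_P ↦ τ_{w P w⁻¹}`. -/
def conjAut (w : W) : MulAut (BigGroup cs) :=
  MonoidHom.toMulEquiv (conjEnd cs w) (conjEnd cs w⁻¹)
    (by rw [← conjEnd_mul, inv_mul_cancel, conjEnd_one])
    (by rw [← conjEnd_mul, mul_inv_cancel, conjEnd_one])

theorem conjAut_tau (w : W) (P : ParabolicConj cs) :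
    conjAut cs w (tau cs P) = tau cs (ParabolicConj.conj cs w P) := conjEnd_tau cs w P

theorem conjAut_mem (w : W) : conjAut cs w ∈ DiagramAut cs := by
  change conjAut cs w '' Set.range (tau cs) = Set.range (tau cs)
  ext x
  constructor
  · rintro ⟨_, ⟨P, rfl⟩, rfl⟩
    exact ⟨_, (conjAut_tau cs w P).symm⟩
  · rintro ⟨P, rfl⟩
    refine ⟨_, ⟨ParabolicConj.conj cs w⁻¹ P, rfl⟩, ?_⟩
    rw [conjAut_tau, ← ParabolicConj.conj_mul, mul_inv_cancel, ParabolicConj.conj_one]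

/-- The homomorphism `W → Aut(𝕎, 𝕊)`, `w ↦ g_w`, where `g_w(τ_P) = τ_{w P w⁻¹}`. -/
def conjDiagram : W →* DiagramAut cs where
  toFun w := ⟨conjAut cs w, conjAut_mem cs w⟩
  map_one' := Subtype.ext <| MulEquiv.ext fun x => DFunLike.congr_fun (conjEnd_one cs) x
  map_mul' w x := Subtype.ext <| MulEquiv.ext fun y =>
    DFunLike.congr_fun (conjEnd_mul cs w x) y

/-- The semidirect product `𝕎 ⋊ Aut(𝕎, 𝕊)` for the tautological action. -/
abbrev BigSemidirect : Type v := BigGroup cs ⋊[(DiagramAut cs).subtype] DiagramAut cs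

end Parabolic

end GenCactus

end

noncomputable section

namespace GenCactus

universe u v

/-! ### The geometric representation: a standard parabolic determines its index set. -/

section GeometricRepresentation

open Polynomial.Chebyshev

/-! Injectivity comes from letting `𝕎` act on the underlying set of `C_W`. At a point `x`, the
involution `τ_P` moves `x` to `x γ_I` if `P` is the conjugate of `W_I` by `g_W(x)`, and fixes `x` if
there is no such `I` (`cactusStep`). The relations of the cactus group are what makes these
involutions commute for nested or orthogonal pairs (`cactusStep_comm`), so they define an action
(`exists_cactusAction`). Passing from `x` to `x γ_I` multiplies the `𝕎`-component of `h(x)` on the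
right by exactly the `τ_P` that moves `x` to `x γ_I` (`left_mul_gam`). By induction the inverse of
that component carries `1` to `x`, so the component alone determines `x` (`left_injective`). This
gives injectivity of `h` and of its restriction to the kernel, where the other component is trivial.

Two facts on Coxeter groups support this. `W_I` determines `I` (`parabolic_injective`, by the
geometric representation), so the step is unambiguous. The longest element of `W_J` is a unique
involution, and conjugation by it preserves length on `W_J` (`IsLongest.length_conj`, by counting
inversions). Hence it permutes the simple reflections of `W_J`, and the cactus relations hold in `W`
and in the semidirect product. -/

theorem eval_S_eq_zero_of_even {k : ℕ} {θ : ℝ} (hθ : k * θ = Real.pi) (hs : Real.sin θ ≠ 0) :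
    (S ℝ ((k : ℤ) - 1)).eval (2 * Real.cos θ) = 0 := by
  have h := S_two_mul_real_cos θ ((k : ℤ) - 1)
  push_cast at h
  rw [sub_add_cancel, hθ, Real.sin_pi] at h
  exact (mul_eq_zero.mp h).resolve_right hs

/-- Multiplied by `sin θ`, the two terms become `sin ((k + 1) θ)` and `sin (k θ)`, and these angles
add up to `2π`. -/
theorem eval_S_add_eval_S_eq_zero_of_odd {k : ℕ} {θ : ℝ} (hθ : (2 * k + 1) * θ = 2 * Real.pi)
    (hs : Real.sin θ ≠ 0) :
    (S ℝ k).eval (2 * Real.cos θ) + (S ℝ ((k : ℤ) - 1)).eval (2 * Real.cos θ) = 0 := by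
  have h := S_two_mul_real_cos θ k
  have h' := S_two_mul_real_cos θ ((k : ℤ) - 1)
  push_cast at h h'
  rw [sub_add_cancel] at h'
  have hk : (k + 1) * θ = 2 * Real.pi - k * θ := by linear_combination hθ
  rw [hk, Real.sin_two_pi_sub] at h
  refine (mul_eq_zero.mp ?_).resolve_right hs
  rw [add_mul, h, h', neg_add_cancel]

theorem reflection_mul_reflection_pow_eq_one {V : Type*} [AddCommGroup V] [Module ℝ V]
    {x y : V} {f g : Module.Dual ℝ V} (hf : f x = 2) (hg : g y = 2) {m : ℕ} (hm : 2 ≤ m)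
    (hfy : f y = -2 * Real.cos (Real.pi / m)) (hgx : g x = -2 * Real.cos (Real.pi / m)) :
    (Module.reflection hf * Module.reflection hg) ^ m = 1 := by
  -- For `m = 2` the angle `2π / m` is `π`, whose sine vanishes, so the division by `sin θ` fails;
  -- there the reflections simply commute.
  obtain rfl | hm : m = 2 ∨ 3 ≤ m := by omega
  · have hfy : f y = 0 := by simpa using hfy
    have hgx : g x = 0 := by simpa using hgx
    ext z
    simp [pow_two, Module.reflection_apply, hf, hg, hfy, hgx]
    module
  have hm' : (3 : ℝ) ≤ m := by exact_mod_cast hm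
  set θ : ℝ := 2 * (Real.pi / m) with hθ
  have hmθ : m * θ = 2 * Real.pi := by rw [hθ]; field_simp
  have hs : Real.sin θ ≠ 0 := by
    have hpi := Real.pi_pos
    refine (Real.sin_pos_of_pos_of_lt_pi (by positivity) ?_).ne'
    nlinarith
  have ht : 2 * Real.cos θ = f y * g x - 2 := by
    rw [hfy, hgx, hθ, Real.cos_two_mul]; ring
  ext z
  rw [Module.reflection_mul_reflection_pow_apply hf hg m z (2 * Real.cos θ) ht]
  obtain ⟨k, rfl | rfl⟩ := Nat.even_or_odd' m
  · have h0 := eval_S_eq_zero_of_even (k := k) (θ := θ) (by push_cast at hmθ; linarith) hs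
    have h1 : ((2 * k : ℕ) - 2 : ℤ) / 2 = k - 1 := by omega
    have h2 : ((2 * k : ℕ) - 1 : ℤ) / 2 = k - 1 := by omega
    rw [h1, h2, h0]
    simp
  · have h0 := eval_S_add_eval_S_eq_zero_of_odd (k := k) (θ := θ) (by exact_mod_cast hmθ) hs
    have h1 : ((2 * k + 1 : ℕ) - 2 : ℤ) / 2 = k - 1 := by omega
    have h2 : ((2 * k + 1 : ℕ) - 1 : ℤ) / 2 = k := by omega
    have h3 : ((2 * k + 1 : ℕ) - 3 : ℤ) / 2 = k - 1 := by omega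
    have h4 : ((2 * k + 1 : ℕ) : ℤ) / 2 = k := by omega
    rw [h1, h2, h3, h4, h0]
    simp

variable {B : Type u} {W : Type v} [Group W] {M : CoxeterMatrix B} (cs : CoxeterSystem M W)

variable (M) in
/-- The functional `2 ⟨e_i, ·⟩` for the standard bilinear form `⟨e_i, e_j⟩ = -cos (π / M i j)`. -/
def simpleCoroot (i : B) : Module.Dual ℝ (B →₀ ℝ) :=
  Finsupp.linearCombination ℝ fun j => -2 * Real.cos (Real.pi / M i j)

theorem simpleCoroot_single (i j : B) :
    simpleCoroot M i (Finsupp.single j 1) = -2 * Real.cos (Real.pi / M i j) := by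
  simp [simpleCoroot]

theorem simpleCoroot_single_self (i : B) : simpleCoroot M i (Finsupp.single i 1) = 2 := by
  simp [simpleCoroot_single]

theorem isLiftable_reflection :
    M.IsLiftable fun i => Module.reflection (simpleCoroot_single_self (M := M) i) := by
  intro i j
  obtain rfl | hij := eq_or_ne i j
  · rw [M.diagonal, pow_one]
    ext z
    rw [LinearEquiv.mul_apply, Module.involutive_reflection]
    rfl
  · obtain h0 | h2 : M i j = 0 ∨ 2 ≤ M i j := by have := M.off_diagonal i j hij; omega
    · rw [h0, pow_zero]
    · refine reflection_mul_reflection_pow_eq_one _ _ h2 (simpleCoroot_single i j) ?_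
      rw [M.symmetric i j]
      exact simpleCoroot_single j i

/-- The geometric representation of a Coxeter group. -/
def geometricRep : W →* ((B →₀ ℝ) ≃ₗ[ℝ] (B →₀ ℝ)) := cs.lift ⟨_, isLiftable_reflection⟩

theorem geometricRep_simple (i : B) (x : B →₀ ℝ) :
    geometricRep cs (cs.simple i) x = x - simpleCoroot M i x • Finsupp.single i 1 := by
  have h : geometricRep cs (cs.simple i) = Module.reflection (simpleCoroot_single_self i) :=
    cs.lift_apply_simple isLiftable_reflection i
  rw [h, Module.reflection_apply]

/-- A simple reflection changes only its own coordinate. -/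
theorem geometricRep_apply_of_notMem {I : Set B} {w : W} (hw : w ∈ parabolic cs I) {j : B}
    (hj : j ∉ I) (x : B →₀ ℝ) : geometricRep cs w x j = x j := by
  induction hw using Subgroup.closure_induction generalizing x with
  | mem w hw =>
    obtain ⟨i, hi, rfl⟩ := hw
    have hij : i ≠ j := fun h => hj (h ▸ hi)
    simp [geometricRep_simple, hij]
  | one => simp
  | mul a b _ _ ha hb => rw [map_mul, LinearEquiv.mul_apply, ha, hb]
  | inv a _ ha =>
    rw [← ha, ← LinearEquiv.mul_apply, ← map_mul, mul_inv_cancel, map_one, LinearEquiv.coe_one,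
      id_eq]

theorem simple_mem_parabolic_iff {I : Set B} {j : B} :
    cs.simple j ∈ parabolic cs I ↔ j ∈ I := by
  refine ⟨fun h => ?_, fun h => Subgroup.subset_closure ⟨j, h, rfl⟩⟩
  by_contra hj
  -- The reflection negates `e_j`, so it does change the `j`-th coordinate.
  have := geometricRep_apply_of_notMem cs h hj (Finsupp.single j 1)
  rw [geometricRep_simple, simpleCoroot_single_self] at this
  norm_num at this

theorem simple_injective : Function.Injective cs.simple := by
  intro i j h
  have : cs.simple i ∈ parabolic cs {j} := by
    rw [h]; exact (simple_mem_parabolic_iff cs).2 rfl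
  exact Set.mem_singleton_iff.1 ((simple_mem_parabolic_iff cs).1 this)

theorem parabolic_le_iff {I J : Set B} : parabolic cs I ≤ parabolic cs J ↔ I ⊆ J :=
  ⟨fun h _ hi => (simple_mem_parabolic_iff cs).1 (h ((simple_mem_parabolic_iff cs).2 hi)),
    fun h => Subgroup.closure_mono (Set.image_mono h)⟩

theorem parabolic_injective : Function.Injective (parabolic cs) := fun _ _ h =>
  ((parabolic_le_iff cs).1 h.le).antisymm ((parabolic_le_iff cs).1 h.ge)

end GeometricRepresentation

/-! ### Inversions as a cocycle modulo 2. -/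

section Inversions

variable {B : Type u} {W : Type v} [Group W] {M : CoxeterMatrix B} (cs : CoxeterSystem M W)

open Classical in
/-- The permutation `(t, ε) ↦ (s t s, ε + [t = s])` of `W × ZMod 2` for an involution `s`. -/
def signedConj (s : W) (hs : s * s = 1) : Equiv.Perm (W × ZMod 2) :=
  Function.Involutive.toPerm (fun p => (s * p.1 * s, p.2 + if p.1 = s then 1 else 0)) <| by
    rintro ⟨t, ε⟩
    have h1 : s * (s * t * s) * s = t := by
      rw [show s * (s * t * s) * s = (s * s) * t * (s * s) by group, hs]; simp
    have h2 : s * t * s = s ↔ t = s :=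
      ⟨fun h => by rw [← h1, h, hs, one_mul], fun h => by rw [h, hs, one_mul]⟩
    ext
    · exact h1
    · simp only [h2, add_assoc]
      split_ifs
      · rw [CharTwo.add_self_eq_zero, add_zero]
      · simp

open Classical in
theorem signedConj_apply (s : W) (hs : s * s = 1) (t : W) (ε : ZMod 2) :
    signedConj s hs (t, ε) = (s * t * s, ε + if t = s then 1 else 0) := rfl

open Classical in
theorem signedConj_mul_pow_apply (s s' : W) (hs : s * s = 1) (hs' : s' * s' = 1) (k : ℕ)
    (t : W) (ε : ZMod 2) :
    ((signedConj s hs * signedConj s' hs') ^ k) (t, ε) =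
      ((s * s') ^ k * t * ((s * s') ^ k)⁻¹,
        ε + ∑ n ∈ Finset.range (2 * k), if t = s' * (s * s') ^ n then 1 else 0) := by
  have hinv : s⁻¹ = s := inv_eq_of_mul_eq_one_right hs
  have hinv' : s'⁻¹ = s' := inv_eq_of_mul_eq_one_right hs'
  have hc (n : ℕ) : s' * (s * s') ^ n = ((s * s') ^ n)⁻¹ * s' := by
    have : s' * (s * s') * s'⁻¹ = (s * s')⁻¹ := by
      rw [mul_inv_rev, hinv, hinv', ← mul_assoc, mul_assoc _ s' s', hs', mul_one]
    rw [← inv_pow, ← this, conj_pow]; group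
  induction k with
  | zero => simp
  | succ k ih =>
    rw [pow_succ', Equiv.Perm.mul_apply, ih, Equiv.Perm.mul_apply]
    have e1 : (s * s') ^ k * t * ((s * s') ^ k)⁻¹ = s' ↔ t = s' * (s * s') ^ (2 * k) := by
      rw [two_mul, pow_add, ← mul_assoc, hc, mul_inv_eq_iff_eq_mul, mul_assoc _ s',
        eq_inv_mul_iff_mul_eq]
    have e2 : s' * ((s * s') ^ k * t * ((s * s') ^ k)⁻¹) * s' = s ↔
        t = s' * (s * s') ^ (2 * k + 1) := by
      have : s' * (s * s') ^ (2 * k + 1) =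
          ((s * s') ^ k)⁻¹ * (s' * s * s') * (s * s') ^ k := by
        rw [show 2 * k + 1 = k + (1 + k) by ring, pow_add, ← mul_assoc, hc, pow_add, pow_one]
        simp only [mul_assoc]
      rw [this]
      generalize (s * s') ^ k = y
      constructor
      · intro h
        rw [show s' * s * s' = s'⁻¹ * s * s'⁻¹ by rw [hinv'], ← h]
        simp only [mul_assoc, inv_mul_cancel_left, mul_inv_cancel, mul_one,
          inv_mul_cancel]
      · intro h
        rw [h]
        rw [show s' * (y * (y⁻¹ * (s' * s * s') * y) * y⁻¹) * s' = (s' * s') * s * (s' * s') by group, hs']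
        simp
    ext
    · simp only [signedConj_apply]
      rw [pow_succ', mul_inv_rev, mul_inv_rev, hinv, hinv']
      simp only [mul_assoc]
    · simp only [signedConj_apply, e1, e2]
      rw [show 2 * (k + 1) = 2 * k + 1 + 1 by ring, Finset.sum_range_succ, Finset.sum_range_succ]
      ring

/-- In the sum over `n < 2m` the terms `n` and `n + m` agree because `(s s')^m = 1`, so they cancel
modulo 2. -/
theorem isLiftable_signedConj :
    M.IsLiftable fun i => signedConj (cs.simple i) (cs.simple_mul_simple_self i) := by
  classical
  intro i j
  ext p : 1
  obtain ⟨t, ε⟩ := p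
  rw [signedConj_mul_pow_apply, cs.simple_mul_simple_pow, two_mul, Finset.sum_range_add]
  simp only [pow_add, cs.simple_mul_simple_pow, one_mul, CharTwo.add_self_eq_zero]
  simp

/-- The action of a Coxeter group on `W × ZMod 2` that records inversions. -/
def inversionRep : W →* Equiv.Perm (W × ZMod 2) := cs.lift ⟨_, isLiftable_signedConj cs⟩

theorem inversionRep_simple (i : B) :
    inversionRep cs (cs.simple i) = signedConj (cs.simple i) (cs.simple_mul_simple_self i) :=
  cs.lift_apply_simple _ _

/-- The indicator of the inversions of `w`, as a cocycle with values in `ZMod 2`. -/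
def inversionParity (w t : W) : ZMod 2 := (inversionRep cs w (t, 0)).2

theorem inversionRep_apply (w t : W) (ε : ZMod 2) :
    inversionRep cs w (t, ε) = (w * t * w⁻¹, ε + inversionParity cs w t) := by
  suffices h : ∀ w : W, ∃ f : W → ZMod 2, ∀ t ε,
      inversionRep cs w (t, ε) = (w * t * w⁻¹, ε + f t) by
    obtain ⟨f, hf⟩ := h w
    rw [inversionParity, hf, hf, zero_add]
  intro w
  induction w using cs.simple_induction_left with
  | one => exact ⟨0, by simp⟩
  | mul_simple_left w i ih =>
    classical
    obtain ⟨f, hf⟩ := ih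
    refine ⟨fun t => f t + if w * t * w⁻¹ = cs.simple i then 1 else 0, fun t ε => ?_⟩
    rw [map_mul, Equiv.Perm.mul_apply, hf, inversionRep_simple, signedConj_apply]
    simp only [mul_inv_rev, cs.inv_simple, mul_assoc, add_assoc]

theorem inversionParity_mul (w x t : W) :
    inversionParity cs (w * x) t =
      inversionParity cs x t + inversionParity cs w (x * t * x⁻¹) := by
  rw [inversionParity, map_mul, Equiv.Perm.mul_apply, inversionRep_apply, inversionRep_apply,
    zero_add]

theorem inversionParity_one (t : W) : inversionParity cs 1 t = 0 := by
  simp [inversionParity]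

open Classical in
theorem inversionParity_simple (i : B) (t : W) :
    inversionParity cs (cs.simple i) t = if t = cs.simple i then 1 else 0 := by
  rw [inversionParity, inversionRep_simple, signedConj_apply, zero_add]

/-- For `t = w s w⁻¹` the contributions of `w` and `w⁻¹` cancel, which leaves that of `s` at `s`. -/
theorem inversionParity_self {t : W} (ht : cs.IsReflection t) : inversionParity cs t t = 1 := by
  obtain ⟨w, i, rfl⟩ := ht
  have h := inversionParity_mul cs w⁻¹ w (cs.simple i)
  rw [inv_mul_cancel, inversionParity_one] at h
  rw [mul_assoc, inversionParity_mul, inversionParity_mul,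
    show cs.simple i * w⁻¹ * (w * (cs.simple i * w⁻¹)) * (cs.simple i * w⁻¹)⁻¹ = cs.simple i by
      group,
    show w⁻¹ * (w * (cs.simple i * w⁻¹)) * w⁻¹⁻¹ = cs.simple i by group, inversionParity_simple,
    if_pos rfl]
  rw [mul_assoc] at h
  linear_combination -h

open Classical in
theorem inversionParity_wordProd (ω : List B) (t : W) :
    inversionParity cs (cs.wordProd ω) t = (cs.rightInvSeq ω).count t := by
  induction ω with
  | nil => simp [inversionParity_one]
  | cons i ω ih =>
    rw [cs.wordProd_cons, inversionParity_mul, ih, inversionParity_simple,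
      CoxeterSystem.rightInvSeq, List.count_cons]
    have : cs.wordProd ω * t * (cs.wordProd ω)⁻¹ = cs.simple i ↔
        ((cs.wordProd ω)⁻¹ * cs.simple i * cs.wordProd ω == t) = true := by
      rw [beq_iff_eq, mul_inv_eq_iff_eq_mul, ← eq_inv_mul_iff_mul_eq, mul_assoc, eq_comm]
    simp only [this]
    push_cast
    rfl

/-- The set of right inversions has `ℓ(w)` elements. -/
theorem exists_inversionFinset (w : W) :
    ∃ F : Finset W, F.card = cs.length w ∧ (∀ t, t ∈ F ↔ inversionParity cs w t ≠ 0) ∧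
      ∀ t ∈ F, cs.IsRightInversion w t := by
  classical
  obtain ⟨ω, hω, rfl⟩ := cs.exists_isReduced w
  refine ⟨(cs.rightInvSeq ω).toFinset, ?_, fun t => ?_, fun t ht => ?_⟩
  -- The inversion sequence of a reduced word has no repetitions, so counting modulo 2 loses
  -- nothing.
  · rw [List.toFinset_card_of_nodup hω.nodup_rightInvSeq, cs.length_rightInvSeq, hω.eq]
  · rw [inversionParity_wordProd, List.mem_toFinset]
    by_cases h : t ∈ cs.rightInvSeq ω
    · simp [h, List.count_eq_one_of_mem hω.nodup_rightInvSeq h]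
    · simp [h, List.count_eq_zero_of_not_mem h]
  · exact cs.isRightInversion_of_mem_rightInvSeq hω (List.mem_toFinset.1 ht)

theorem inversionParity_ne_zero_iff {w t : W} (ht : cs.IsReflection t) :
    inversionParity cs w t ≠ 0 ↔ cs.length (w * t) < cs.length w := by
  have key (w : W) (h : inversionParity cs w t ≠ 0) : cs.length (w * t) < cs.length w := by
    obtain ⟨F, -, hF, hinv⟩ := exists_inversionFinset cs w
    exact (hinv t ((hF t).2 h)).2
  refine ⟨key w, fun h h0 => ?_⟩
  -- Multiplication by `t` flips the parity at `t`, so a non-inversion of `w` is an inversion of `w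
  -- t`.
  have := key (w * t) (by
    rw [inversionParity_mul, inversionParity_self cs ht, mul_inv_cancel_right, h0]; simp)
  rw [mul_assoc, ht.mul_self, mul_one] at this
  omega

theorem isReflection_of_inversionParity_ne_zero {w t : W} (h : inversionParity cs w t ≠ 0) :
    cs.IsReflection t := by
  obtain ⟨F, -, hF, hinv⟩ := exists_inversionFinset cs w
  exact (hinv t ((hF t).2 h)).1

/-- The cocycle identity allows induction over the subgroup closure, with no need for reduced words
with letters in `I`. -/
theorem mem_parabolic_of_inversionParity_ne_zero {I : Set B} {w t : W}
    (hw : w ∈ parabolic cs I) (h : inversionParity cs w t ≠ 0) : t ∈ parabolic cs I := by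
  induction hw using Subgroup.closure_induction generalizing t with
  | mem w hw =>
    obtain ⟨i, hi, rfl⟩ := hw
    rw [inversionParity_simple] at h
    rw [show t = cs.simple i by simpa using h]
    exact Subgroup.subset_closure ⟨i, hi, rfl⟩
  | one => exact absurd (inversionParity_one cs t) h
  | mul a b ha hb iha ihb =>
    rw [inversionParity_mul] at h
    by_cases h0 : inversionParity cs b t = 0
    · rw [h0, zero_add] at h
      have := iha h
      rwa [(parabolic cs I).mul_mem_cancel_right ((parabolic cs I).inv_mem hb),
        (parabolic cs I).mul_mem_cancel_left hb] at this
    · exact ihb h0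
  | inv a ha iha =>
    have h1 := inversionParity_mul cs a a⁻¹ t
    rw [mul_inv_cancel, inversionParity_one] at h1
    have : inversionParity cs a (a⁻¹ * t * a⁻¹⁻¹) ≠ 0 := fun h0 => h (by rw [h1, h0, add_zero])
    have := iha this
    rwa [inv_inv, (parabolic cs I).mul_mem_cancel_right ha,
      (parabolic cs I).mul_mem_cancel_left ((parabolic cs I).inv_mem ha)] at this

end Inversions

/-! ### Longest elements of standard parabolic subgroups. -/

section Longest

variable {B : Type u} {W : Type v} [Group W] {M : CoxeterMatrix B} (cs : CoxeterSystem M W)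

/-- `w` is an element of maximal length of `W_I`. -/
def IsLongest (I : Set B) (w : W) : Prop :=
  w ∈ parabolic cs I ∧ ∀ v ∈ parabolic cs I, cs.length v ≤ cs.length w

variable {cs} {I : Set B} {w : W}

/-- By maximality every reflection of `W_I` is an inversion of `w`. The inversions of `w u` are
therefore the reflections of `W_I` that are not inversions of `u`. -/
theorem IsLongest.length_mul_add_length (hw : IsLongest cs I w) {u : W}
    (hu : u ∈ parabolic cs I) : cs.length (w * u) + cs.length u = cs.length w := by
  classical
  have hfull {t : W} (ht : cs.IsReflection t) (htI : t ∈ parabolic cs I) :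
      inversionParity cs w t ≠ 0 :=
    (inversionParity_ne_zero_iff cs ht).2 <| lt_of_le_of_ne
      (hw.2 _ (Subgroup.mul_mem _ hw.1 htI)) (ht.length_mul_left_ne w)
  obtain ⟨F, hFc, hF, -⟩ := exists_inversionFinset cs w
  obtain ⟨G, hGc, hG, -⟩ := exists_inversionFinset cs u
  obtain ⟨H, hHc, hH, -⟩ := exists_inversionFinset cs (w * u)
  have hGF : G ⊆ F := fun t ht => by
    have h := (hG t).1 ht
    exact (hF t).2 (hfull (isReflection_of_inversionParity_ne_zero cs h)
      (mem_parabolic_of_inversionParity_ne_zero cs hu h))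
  have two (a : ZMod 2) : a ≠ 0 ↔ a = 1 := by revert a; decide
  have hconj {t : W} : t ∈ F ↔ inversionParity cs w (u * t * u⁻¹) ≠ 0 := by
    rw [hF]
    constructor
    · intro h
      exact hfull ((isReflection_of_inversionParity_ne_zero cs h).conj u) <|
        Subgroup.mul_mem _ (Subgroup.mul_mem _ hu
          (mem_parabolic_of_inversionParity_ne_zero cs hw.1 h)) (Subgroup.inv_mem _ hu)
    · intro h
      have h1 := isReflection_of_inversionParity_ne_zero cs h
      have h2 := mem_parabolic_of_inversionParity_ne_zero cs hw.1 h
      rw [cs.isReflection_conj_iff] at h1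
      rw [(parabolic cs I).mul_mem_cancel_right ((parabolic cs I).inv_mem hu),
        (parabolic cs I).mul_mem_cancel_left hu] at h2
      exact hfull h1 h2
  have hHF : H = F \ G := by
    ext t
    rw [Finset.mem_sdiff, hH, inversionParity_mul]
    by_cases h1 : t ∈ G
    · have h2 := (two _).1 (hconj.1 (hGF h1))
      have h3 := (two _).1 ((hG t).1 h1)
      rw [h2, h3]
      simp only [h1, not_true_eq_false, and_false, iff_false, not_not]
      decide
    · have h3 : inversionParity cs u t = 0 := by
        by_contra h; exact h1 ((hG t).2 h)
      rw [h3, zero_add, ← hconj]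
      simp [h1]
  rw [← hHc, ← hGc, ← hFc, hHF, Finset.card_sdiff_add_card_eq_card hGF]

/-- For `u = w⁻¹ w'` the length formula gives `ℓ(w') + ℓ(u) = ℓ(w) ≤ ℓ(w')`, which forces `u = 1`.
-/
theorem IsLongest.eq {w' : W} (hw : IsLongest cs I w) (hw' : IsLongest cs I w') : w = w' := by
  have h := hw.length_mul_add_length (Subgroup.mul_mem _ (Subgroup.inv_mem _ hw.1) hw'.1)
  rw [mul_inv_cancel_left] at h
  have := hw'.2 w hw.1
  exact inv_mul_eq_one.1 (cs.length_eq_zero_iff.1 (by omega))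

theorem IsLongest.inv (hw : IsLongest cs I w) : w⁻¹ = w :=
  IsLongest.eq ⟨Subgroup.inv_mem _ hw.1, fun v hv => by rw [cs.length_inv]; exact hw.2 v hv⟩ hw

/-- Both lengths complement `ℓ(w u)` to `ℓ(w)`: as `w` is an involution, `w (w u w⁻¹)⁻¹ = (w u)⁻¹`.
-/
theorem IsLongest.length_conj (hw : IsLongest cs I w) {u : W} (hu : u ∈ parabolic cs I) :
    cs.length (w * u * w⁻¹) = cs.length u := by
  have hx : w * u * w⁻¹ ∈ parabolic cs I :=
    Subgroup.mul_mem _ (Subgroup.mul_mem _ hw.1 hu) (Subgroup.inv_mem _ hw.1)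
  have h1 := hw.length_mul_add_length hu
  have h2 := hw.length_mul_add_length (Subgroup.inv_mem _ hx)
  have h3 : w * (w * u * w⁻¹)⁻¹ = (w * u)⁻¹ := by
    nth_rw 1 [← hw.inv]; group
  rw [h3, cs.length_inv, cs.length_inv] at h2
  omega

theorem IsLongest.exists_conj_simple (hw : IsLongest cs I w) {i : B} (hi : i ∈ I) :
    ∃ k ∈ I, w * cs.simple i * w⁻¹ = cs.simple k := by
  have hs : cs.simple i ∈ parabolic cs I := (simple_mem_parabolic_iff cs).2 hi
  have h := hw.length_conj hs
  rw [cs.length_simple, cs.length_eq_one_iff] at h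
  obtain ⟨k, hk⟩ := h
  refine ⟨k, (simple_mem_parabolic_iff cs).1 ?_, hk⟩
  rw [← hk]
  exact Subgroup.mul_mem _ (Subgroup.mul_mem _ hw.1 hs) (Subgroup.inv_mem _ hw.1)

end Longest

/-! ### Conjugation by longest elements, orthogonality, and the cactus relations. -/

section Cactus

variable {B : Type u} {W : Type v} [Group W] {M : CoxeterMatrix B} (cs : CoxeterSystem M W)

theorem isLongest_longest (I : ConnectedFamily cs) : IsLongest cs I.1 (longest cs I) :=
  ⟨longest_mem cs I, fun _ hv => length_le_longest cs I hv⟩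

theorem longest_mul_self (I : ConnectedFamily cs) : longest cs I * longest cs I = 1 := by
  nth_rw 1 [← (isLongest_longest cs I).inv]
  exact inv_mul_cancel _

theorem map_conj_parabolic {I K : Set B} {x : W}
    (h : cs.simple '' K = (fun y => x * y * x⁻¹) '' (cs.simple '' I)) :
    (parabolic cs I).map (MulAut.conj x).toMonoidHom = parabolic cs K := by
  rw [parabolic, parabolic, MonoidHom.map_closure, h]
  rfl

theorem IsDirectProduct.map {W' : Type*} [Group W'] {L H K : Subgroup W}
    (h : IsDirectProduct L H K) {f : W →* W'} (hf : Function.Injective f) :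
    IsDirectProduct (L.map f) (H.map f) (K.map f) := by
  refine ⟨by rw [h.1, Subgroup.map_sup], ?_, ?_⟩
  · rw [← Subgroup.map_inf _ _ _ hf, h.2.1, Subgroup.map_bot]
  · rintro _ ⟨a, ha, rfl⟩ _ ⟨b, hb, rfl⟩
    exact (h.2.2 a ha b hb).map f

/-- A splitting of `K` pulls back along conjugation by `x` to a splitting of `I`. -/
theorem IsConnectedSubset.of_image_conj {I K : Set B} {x : W} (hI : IsConnectedSubset cs I)
    (h : cs.simple '' K = (fun y => x * y * x⁻¹) '' (cs.simple '' I)) :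
    IsConnectedSubset cs K := by
  have hinj := simple_injective cs
  obtain ⟨hne, hfin, hconn⟩ := hI
  refine ⟨?_, ?_, ?_⟩
  · rw [← Set.image_nonempty (f := cs.simple), h]
    exact (hne.image _).image _
  · rw [← map_conj_parabolic cs h]
    exact hfin.image _
  · rintro ⟨J, L, hJ, hL, hd, rfl, hp⟩
    have h' : cs.simple '' I = (fun y => x⁻¹ * y * x⁻¹⁻¹) '' (cs.simple '' (J ∪ L)) := by
      rw [h, Set.image_image]
      simp [mul_assoc]
    have pull {A : Set B} (hA : A ⊆ J ∪ L) :
        cs.simple '' (cs.simple ⁻¹' ((fun y => x⁻¹ * y * x⁻¹⁻¹) '' (cs.simple '' A))) =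
          (fun y => x⁻¹ * y * x⁻¹⁻¹) '' (cs.simple '' A) := by
      apply Set.image_preimage_eq_of_subset
      refine (Set.image_mono (Set.image_mono hA)).trans ?_
      rw [← h']
      exact Set.image_subset_range _ _
    have pJ := pull (Set.subset_union_left (s := J) (t := L))
    have pL := pull (Set.subset_union_right (s := J) (t := L))
    have cinj : Function.Injective fun y => x⁻¹ * y * x⁻¹⁻¹ := (MulAut.conj x⁻¹).injective
    refine hconn ⟨cs.simple ⁻¹' ((fun y => x⁻¹ * y * x⁻¹⁻¹) '' (cs.simple '' J)),
      cs.simple ⁻¹' ((fun y => x⁻¹ * y * x⁻¹⁻¹) '' (cs.simple '' L)), ?_, ?_, ?_, ?_, ?_⟩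
    · rw [← Set.image_nonempty (f := cs.simple), pJ]
      exact (hJ.image _).image _
    · rw [← Set.image_nonempty (f := cs.simple), pL]
      exact (hL.image _).image _
    · exact ((((Set.disjoint_image_iff hinj).2 hd).image cinj.injOn (Set.subset_univ _)
        (Set.subset_univ _))).preimage _
    · apply hinj.image_injective
      rw [Set.image_union, pJ, pL, h', Set.image_union, Set.image_union]
    · rw [← map_conj_parabolic cs h', ← map_conj_parabolic cs pJ, ← map_conj_parabolic cs pL]
      exact hp.map (MulAut.conj x⁻¹).injective

theorem IsConjBy.map_eq {I J K : ConnectedFamily cs} (h : IsConjBy cs J I K) :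
    (parabolic cs I.1).map (MulAut.conj (longest cs J)).toMonoidHom = parabolic cs K.1 :=
  map_conj_parabolic cs h

theorem IsConjBy.conj_std {I J K : ConnectedFamily cs} (h : IsConjBy cs J I K) :
    ParabolicConj.conj cs (longest cs J) (.std cs I) = .std cs K :=
  Subtype.ext (h.map_eq cs)

theorem std_injective : Function.Injective (ParabolicConj.std cs) := fun _ _ h =>
  Subtype.ext (parabolic_injective cs (congrArg Subtype.val h))

theorem isConjBy_of_commute {I J : ConnectedFamily cs}
    (h : ∀ a ∈ parabolic cs I.1, ∀ b ∈ parabolic cs J.1, Commute a b) : IsConjBy cs J I I := by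
  have : Set.EqOn (fun x => longest cs J * x * (longest cs J)⁻¹) id (cs.simple '' I.1) := by
    rintro _ ⟨i, hi, rfl⟩
    have := h _ ((simple_mem_parabolic_iff cs).2 hi) _ (longest_mem cs J)
    simp only [id]
    rw [← this.eq, mul_inv_cancel_right]
  rw [IsConjBy, this.image_eq, Set.image_id]

theorem Compatible.exists_isConjBy {I J : ConnectedFamily cs} (h : Compatible cs I J) :
    ∃ K : ConnectedFamily cs, IsConjBy cs J I K := by
  obtain h | h := h
  · have h' : cs.simple '' (cs.simple ⁻¹'
        ((fun x => longest cs J * x * (longest cs J)⁻¹) '' (cs.simple '' I.1))) =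
        (fun x => longest cs J * x * (longest cs J)⁻¹) '' (cs.simple '' I.1) := by
      apply Set.image_preimage_eq_of_subset
      rintro _ ⟨_, ⟨i, hi, rfl⟩, rfl⟩
      obtain ⟨k, -, hk⟩ := (isLongest_longest cs J).exists_conj_simple (h hi)
      exact ⟨k, hk.symm⟩
    exact ⟨⟨_, I.2.of_image_conj cs h'⟩, h'⟩
  · exact ⟨I, isConjBy_of_commute cs h.2.2⟩

theorem IsConjBy.unique {I J K K' : ConnectedFamily cs} (h : IsConjBy cs J I K)
    (h' : IsConjBy cs J I K') : K = K' :=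
  Subtype.ext ((simple_injective cs).image_injective (h.trans h'.symm))

theorem IsConjBy.eq_of_commute {I J K : ConnectedFamily cs} (hK : IsConjBy cs J I K)
    (h : ∀ a ∈ parabolic cs I.1, ∀ b ∈ parabolic cs J.1, Commute a b) : K = I :=
  hK.unique cs (isConjBy_of_commute cs h)

/-- In the nested case, conjugation by `w_J` preserves length on `W_J`, hence carries the longest
element of `W_I` to that of `W_K`; in the product case it acts trivially. -/
theorem IsConjBy.longest_conj {I J K : ConnectedFamily cs} (hK : IsConjBy cs J I K)
    (h : Compatible cs I J) :
    longest cs J * longest cs I * (longest cs J)⁻¹ = longest cs K := by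
  obtain h | h := h
  · have hIJ := (parabolic_le_iff cs).2 h
    refine IsLongest.eq (I := K.1) ⟨?_, fun v hv => ?_⟩ (isLongest_longest cs K)
    · rw [← hK.map_eq cs]
      exact Subgroup.mem_map_of_mem (MulAut.conj (longest cs J)).toMonoidHom (longest_mem cs I)
    · rw [← hK.map_eq cs] at hv
      obtain ⟨u, hu, rfl⟩ := hv
      rw [(isLongest_longest cs J).length_conj (hIJ (longest_mem cs I))]
      change cs.length (longest cs J * u * (longest cs J)⁻¹) ≤ _
      rw [(isLongest_longest cs J).length_conj (hIJ hu)]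
      exact length_le_longest cs I hu
  · rw [hK.eq_of_commute cs h.2.2, ← (h.2.2 _ (longest_mem cs I) _ (longest_mem cs J)).eq,
      mul_inv_cancel_right]

theorem IsConjBy.longest_mul {I J K : ConnectedFamily cs} (hK : IsConjBy cs J I K)
    (h : Compatible cs I J) :
    longest cs I * longest cs J = longest cs J * longest cs K := by
  rw [← hK.longest_conj cs h, (isLongest_longest cs J).inv, ← mul_assoc, ← mul_assoc,
    longest_mul_self, one_mul]

theorem conj_eq_self_of_mem {w : W} {P : ParabolicConj cs} (h : w ∈ P.1) :
    ParabolicConj.conj cs w P = P := by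
  apply Subtype.ext
  ext x
  refine Subgroup.mem_map_equiv.trans ?_
  rw [MulAut.conj_symm_apply, P.1.mul_mem_cancel_right h,
    P.1.mul_mem_cancel_left (P.1.inv_mem h)]

theorem conj_eq_self_of_commute {w : W} {P : ParabolicConj cs} (h : ∀ x ∈ P.1, Commute x w) :
    ParabolicConj.conj cs w P = P := by
  apply Subtype.ext
  have h' : Set.EqOn (MulAut.conj w) id (P.1 : Set W) := fun x hx => by
    simp [← (h x hx).eq]
  apply SetLike.coe_injective
  change MulAut.conj w '' (P.1 : Set W) = _
  rw [h'.image_eq, Set.image_id]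

/-- This is the asymmetry of the relation: `w_I` normalizes `W_J`, while `w_J` may move `W_I` to
another `W_K`. -/
theorem Compatible.conj_longest {I J : ConnectedFamily cs} (h : Compatible cs I J) :
    ParabolicConj.conj cs (longest cs I) (.std cs J) = .std cs J := by
  obtain h | h := h
  · exact conj_eq_self_of_mem cs ((parabolic_le_iff cs).2 h (longest_mem cs I))
  · exact conj_eq_self_of_commute cs fun y hy => (h.2.2 _ (longest_mem cs I) y hy).symm

theorem tau_mul_self (P : ParabolicConj cs) : tau cs P * tau cs P = 1 :=
  (bigMatrix cs).toCoxeterSystem.simple_mul_simple_self P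

/-- Two members of `𝕊` commute if they are nested, or if they generate their direct product. -/
def Orthogonal (P Q : ParabolicConj cs) : Prop :=
  P.1 ≤ Q.1 ∨ Q.1 ≤ P.1 ∨ (P.1 ⊓ Q.1 = ⊥ ∧ ∀ x ∈ P.1, ∀ y ∈ Q.1, Commute x y)

variable {cs} in
theorem Orthogonal.symm {P Q : ParabolicConj cs} (h : Orthogonal cs P Q) : Orthogonal cs Q P := by
  obtain h | h | h := h
  · exact .inr (.inl h)
  · exact .inl h
  · exact .inr (.inr ⟨inf_comm P.1 Q.1 ▸ h.1, fun x hx y hy => (h.2 y hy x hx).symm⟩)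

theorem le_centralizer_iff_forall_commute {P Q : Subgroup W} :
    Q ≤ Subgroup.centralizer (P : Set W) ↔ ∀ x ∈ P, ∀ y ∈ Q, Commute x y :=
  ⟨fun h x hx _ hy => h hy x hx, fun h y hy x hx => h x hx y hy⟩

open Classical in
theorem bigMatrix_apply (P Q : ParabolicConj cs) :
    bigMatrix cs P Q = if P = Q then 1 else if P.1 ≤ Q.1 ∨ Q.1 ≤ P.1 then 2
      else if P.1 ⊓ Q.1 = ⊥ ∧ Q.1 ≤ Subgroup.centralizer (P.1 : Set W) then 2 else 0 := rfl

theorem bigMatrix_cases (P Q : ParabolicConj cs) :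
    P = Q ∨ (bigMatrix cs P Q = 2 ∧ Orthogonal cs P Q) ∨ bigMatrix cs P Q = 0 := by
  rw [bigMatrix_apply]
  split_ifs with h1 h2 h3
  · exact .inl h1
  · exact .inr (.inl ⟨rfl, h2.elim .inl fun h => .inr (.inl h)⟩)
  · exact .inr (.inl ⟨rfl, .inr (.inr ⟨h3.1, le_centralizer_iff_forall_commute.1 h3.2⟩)⟩)
  · exact .inr (.inr rfl)

theorem Orthogonal.bigMatrix_eq {P Q : ParabolicConj cs} (h : Orthogonal cs P Q) (hne : P ≠ Q) :
    bigMatrix cs P Q = 2 := by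
  rw [bigMatrix_apply, if_neg hne]
  split_ifs with h2 h3
  · rfl
  · rfl
  · obtain h | h | h := h
    · exact absurd (.inl h) h2
    · exact absurd (.inr h) h2
    · exact absurd ⟨h.1, le_centralizer_iff_forall_commute.2 h.2⟩ h3

theorem Orthogonal.commute_tau {P Q : ParabolicConj cs} (h : Orthogonal cs P Q) :
    Commute (tau cs P) (tau cs Q) := by
  obtain rfl | hne := eq_or_ne P Q
  · exact Commute.refl _
  have h1 := (bigMatrix cs).toCoxeterSystem.simple_mul_simple_pow P Q
  rw [h.bigMatrix_eq cs hne] at h1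
  change (tau cs P * tau cs Q) ^ 2 = 1 at h1
  have hP : (tau cs P)⁻¹ = tau cs P := inv_eq_of_mul_eq_one_right (tau_mul_self cs P)
  have hQ : (tau cs Q)⁻¹ = tau cs Q := inv_eq_of_mul_eq_one_right (tau_mul_self cs Q)
  have h2 : tau cs P * tau cs Q = (tau cs P * tau cs Q)⁻¹ :=
    eq_inv_of_mul_eq_one_left (by rw [← pow_two, h1])
  rw [mul_inv_rev, hP, hQ] at h2
  exact h2

theorem Orthogonal.conj {P Q : ParabolicConj cs} (h : Orthogonal cs P Q) (w : W) :
    Orthogonal cs (ParabolicConj.conj cs w P) (ParabolicConj.conj cs w Q) := by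
  obtain h | h | h := h
  · exact .inl (Subgroup.map_mono h)
  · exact .inr (.inl (Subgroup.map_mono h))
  · refine .inr (.inr ⟨?_, ?_⟩)
    · change P.1.map _ ⊓ Q.1.map _ = ⊥
      rw [← Subgroup.map_inf _ _ _ (MulAut.conj w).injective, h.1, Subgroup.map_bot]
    · rintro _ ⟨x, hx, rfl⟩ _ ⟨y, hy, rfl⟩
      exact (h.2 x hx y hy).map (MulAut.conj w).toMonoidHom

theorem Compatible.orthogonal {I J : ConnectedFamily cs} (h : Compatible cs I J) :
    Orthogonal cs (.std cs I) (.std cs J) := by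
  obtain h | h := h
  · exact .inl ((parabolic_le_iff cs).2 h)
  · exact .inr (.inr ⟨h.2.1, h.2.2⟩)

theorem Orthogonal.compatible {I J : ConnectedFamily cs}
    (h : Orthogonal cs (.std cs I) (.std cs J)) : Compatible cs I J ∨ J.1 ⊆ I.1 := by
  obtain h | h | h := h
  · exact .inl (.inl ((parabolic_le_iff cs).1 h))
  · exact .inr ((parabolic_le_iff cs).1 h)
  · refine .inl (.inr ⟨?_, h.1, h.2⟩)
    rw [parabolic, Set.image_union, Subgroup.closure_union]
    rfl

/-- A member of `𝕊` orthogonal to `W_I` is fixed by `w_I` unless it is contained in `W_I`. -/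
theorem Orthogonal.conj_longest {I : ConnectedFamily cs} {Q : ParabolicConj cs}
    (h : Orthogonal cs (.std cs I) Q) (hQ : ¬ Q.1 ≤ parabolic cs I.1) :
    ParabolicConj.conj cs (longest cs I) Q = Q := by
  obtain h | h | h := h
  · exact conj_eq_self_of_mem cs (h (longest_mem cs I))
  · exact absurd h hQ
  · exact conj_eq_self_of_commute cs fun x hx => (h.2 _ (longest_mem cs I) x hx).symm

/-- Conjugation by `w_I` preserves standardness of members of `𝕊` orthogonal to `W_I`. -/
theorem Orthogonal.exists_std_iff {I : ConnectedFamily cs} {Q : ParabolicConj cs}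
    (h : Orthogonal cs (.std cs I) Q)
    (hQ : ∃ K, .std cs K = ParabolicConj.conj cs (longest cs I) Q) :
    ∃ K, .std cs K = Q := by
  by_cases hle : Q.1 ≤ parabolic cs I.1
  · obtain ⟨K, hK⟩ := hQ
    -- As `w_I` is an involution, `Q` is the `w_I`-conjugate of `W_K`, and `K ⊆ I` makes that
    -- conjugate standard again.
    have hQ' : ParabolicConj.conj cs (longest cs I) (.std cs K) = Q := by
      rw [hK, ← ParabolicConj.conj_mul, longest_mul_self, ParabolicConj.conj_one]
    have hKI : K.1 ⊆ I.1 := by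
      rw [← parabolic_le_iff cs]
      have h1 : parabolic cs K.1 = Q.1.map (MulAut.conj (longest cs I)).toMonoidHom :=
        congrArg Subtype.val hK
      rw [h1]
      rintro _ ⟨x, hx, rfl⟩
      exact Subgroup.mul_mem _ (Subgroup.mul_mem _ (longest_mem cs I) (hle hx))
        (Subgroup.inv_mem _ (longest_mem cs I))
    obtain ⟨L, hL⟩ := Compatible.exists_isConjBy cs (I := K) (J := I) (.inl hKI)
    exact ⟨L, by rw [← hL.conj_std cs, hQ']⟩
  · rwa [h.conj_longest cs hle] at hQ

theorem gam_mul_self (I : ConnectedFamily cs) : gam cs I * gam cs I = 1 := by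
  rw [← pow_two]
  exact PresentedGroup.one_of_mem (rels := cactusRelators cs) (.inl ⟨I, rfl⟩)

theorem gam_mul_gam {I J K : ConnectedFamily cs} (h : Compatible cs I J)
    (hK : IsConjBy cs J I K) : gam cs I * gam cs J = gam cs J * gam cs K :=
  PresentedGroup.mk_eq_mk_of_mul_inv_mem (rels := cactusRelators cs)
    (.inr ⟨I, J, K, h, hK, rfl⟩)

/-- A family that satisfies the cactus relations extends to the cactus group. -/
theorem exists_cactus_lift {G : Type*} [Group G] (f : ConnectedFamily cs → G)
    (h1 : ∀ I, f I * f I = 1)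
    (h2 : ∀ I J K, Compatible cs I J → IsConjBy cs J I K → f I * f J = f J * f K) :
    ∃ φ : CactusGroup cs →* G, ∀ I, φ (gam cs I) = f I := by
  have hr : ∀ r ∈ cactusRelators cs, FreeGroup.lift f r = 1 := by
    rintro r (⟨I, rfl⟩ | ⟨I, J, K, h, hK, rfl⟩)
    · rw [map_pow, FreeGroup.lift_apply_of, pow_two, h1]
    · simp only [map_mul, map_inv, FreeGroup.lift_apply_of]
      rw [h2 I J K h hK, mul_inv_cancel]
  exact ⟨PresentedGroup.toGroup hr, fun I => PresentedGroup.toGroup.of hr⟩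

theorem cactus_induction {p : CactusGroup cs → Prop} (one : p 1)
    (mul_gam : ∀ x I, p x → p (x * gam cs I)) (x : CactusGroup cs) : p x := by
  have hx : x ∈ Subgroup.closure (Set.range (gam cs)) := by
    have := PresentedGroup.closure_range_of (cactusRelators cs)
    exact this ▸ Subgroup.mem_top x
  induction hx using Subgroup.closure_induction_right with
  | one => exact one
  | mul_right y _ _ hz ih =>
    obtain ⟨I, rfl⟩ := hz
    exact mul_gam y I ih
  | mul_inv_cancel y _ _ hz ih =>
    obtain ⟨I, rfl⟩ := hz
    rw [inv_eq_of_mul_eq_one_right (gam_mul_self cs I)]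
    exact mul_gam y I ih

/-! ### The action of the right-angled group on the cactus group. -/

section Step

variable (φ : CactusGroup cs →* W)

open Classical in
/-- The action of `τ_P` on the cactus group: `x` goes to `x γ_I` if `P` is the conjugate of `W_I`
by the image of `x`, and is fixed if there is no such `I`. -/
def cactusStep (P : ParabolicConj cs) (x : CactusGroup cs) : CactusGroup cs :=
  if h : ∃ I, ParabolicConj.conj cs (φ x) (.std cs I) = P then x * gam cs h.choose else x

theorem cactusStep_conj_std (x : CactusGroup cs) (I : ConnectedFamily cs) :
    cactusStep cs φ (ParabolicConj.conj cs (φ x) (.std cs I)) x = x * gam cs I := by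
  have h : ∃ J, ParabolicConj.conj cs (φ x) (.std cs J) = ParabolicConj.conj cs (φ x) (.std cs I) :=
    ⟨I, rfl⟩
  rw [cactusStep, dif_pos h]
  rw [std_injective cs (ParabolicConj.conj_injective cs _ h.choose_spec)]

theorem cactusStep_conj_of_not_exists (x : CactusGroup cs) {Q : ParabolicConj cs}
    (hQ : ¬ ∃ I, .std cs I = Q) : cactusStep cs φ (ParabolicConj.conj cs (φ x) Q) x = x := by
  rw [cactusStep, dif_neg]
  rintro ⟨I, hI⟩
  exact hQ ⟨I, ParabolicConj.conj_injective cs _ hI⟩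

theorem exists_conj_eq (w : W) (P : ParabolicConj cs) : ∃ Q, ParabolicConj.conj cs w Q = P :=
  ⟨ParabolicConj.conj cs w⁻¹ P, by
    rw [← ParabolicConj.conj_mul, mul_inv_cancel, ParabolicConj.conj_one]⟩

variable {φ} (hφ : ∀ I, φ (gam cs I) = longest cs I)
include hφ

/-- Change of base point: what looks like `Q` from `x` looks like `w_I Q w_I⁻¹` from `x γ_I`. This
is how a second step is evaluated after a first. -/
theorem conj_eq_conj_mul_gam (x : CactusGroup cs) (I : ConnectedFamily cs)
    (Q : ParabolicConj cs) :
    ParabolicConj.conj cs (φ x) Q =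
      ParabolicConj.conj cs (φ (x * gam cs I)) (ParabolicConj.conj cs (longest cs I) Q) := by
  rw [map_mul, hφ, ← ParabolicConj.conj_mul, mul_assoc, longest_mul_self, mul_one]

theorem cactusStep_involutive (P : ParabolicConj cs) :
    Function.Involutive (cactusStep cs φ P) := by
  intro x
  obtain ⟨Q, rfl⟩ := exists_conj_eq cs (φ x) P
  by_cases hQ : ∃ I, .std cs I = Q
  · obtain ⟨I, rfl⟩ := hQ
    rw [cactusStep_conj_std, conj_eq_conj_mul_gam cs hφ x I,
      conj_eq_self_of_mem cs (P := .std cs I) (longest_mem cs I), cactusStep_conj_std,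
      mul_assoc, gam_mul_self, mul_one]
  · rw [cactusStep_conj_of_not_exists cs φ x hQ, cactusStep_conj_of_not_exists cs φ x hQ]

/-- Both orders give `x γ_I`: seen from `x γ_I`, the second subgroup is `w_I Q w_I⁻¹`, which is
still not standard. -/
theorem cactusStep_comm_of_not_exists {x : CactusGroup cs} {I : ConnectedFamily cs}
    {Q : ParabolicConj cs} (h : Orthogonal cs (.std cs I) Q) (hQ : ¬ ∃ J, .std cs J = Q) :
    cactusStep cs φ (ParabolicConj.conj cs (φ x) Q)
        (cactusStep cs φ (ParabolicConj.conj cs (φ x) (.std cs I)) x) =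
      cactusStep cs φ (ParabolicConj.conj cs (φ x) (.std cs I))
        (cactusStep cs φ (ParabolicConj.conj cs (φ x) Q) x) := by
  rw [cactusStep_conj_of_not_exists cs φ x hQ, cactusStep_conj_std,
    conj_eq_conj_mul_gam cs hφ x I, cactusStep_conj_of_not_exists]
  exact fun hK => hQ (h.exists_std_iff cs hK)

/-- One order gives `x γ_I γ_J` because `w_I` normalizes `W_J`; the other gives `x γ_J γ_K` with `K
= w_J(I)`. The defining relation identifies them. -/
theorem cactusStep_comm_of_compatible {x : CactusGroup cs} {I J : ConnectedFamily cs}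
    (h : Compatible cs I J) :
    cactusStep cs φ (ParabolicConj.conj cs (φ x) (.std cs J))
        (cactusStep cs φ (ParabolicConj.conj cs (φ x) (.std cs I)) x) =
      cactusStep cs φ (ParabolicConj.conj cs (φ x) (.std cs I))
        (cactusStep cs φ (ParabolicConj.conj cs (φ x) (.std cs J)) x) := by
  obtain ⟨K, hK⟩ := h.exists_isConjBy cs
  rw [cactusStep_conj_std, cactusStep_conj_std, conj_eq_conj_mul_gam cs hφ x I, h.conj_longest cs,
    cactusStep_conj_std, conj_eq_conj_mul_gam cs hφ x J, hK.conj_std cs, cactusStep_conj_std,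
    mul_assoc, mul_assoc, gam_mul_gam cs h hK]

theorem cactusStep_comm {P Q : ParabolicConj cs} (h : Orthogonal cs P Q) (x : CactusGroup cs) :
    cactusStep cs φ Q (cactusStep cs φ P x) = cactusStep cs φ P (cactusStep cs φ Q x) := by
  obtain ⟨P, rfl⟩ := exists_conj_eq cs (φ x) P
  obtain ⟨Q, rfl⟩ := exists_conj_eq cs (φ x) Q
  have h' : Orthogonal cs P Q := by
    have := h.conj cs (φ x)⁻¹
    simpa only [← ParabolicConj.conj_mul, inv_mul_cancel, ParabolicConj.conj_one] using this
  by_cases hP : ∃ I, .std cs I = P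
  · obtain ⟨I, rfl⟩ := hP
    by_cases hQ : ∃ J, .std cs J = Q
    · obtain ⟨J, rfl⟩ := hQ
      obtain h1 | h1 := h'.compatible cs
      · exact cactusStep_comm_of_compatible cs hφ h1
      · exact (cactusStep_comm_of_compatible cs hφ (.inl h1)).symm
    · exact cactusStep_comm_of_not_exists cs hφ h' hQ
  · by_cases hQ : ∃ J, .std cs J = Q
    · obtain ⟨J, rfl⟩ := hQ
      exact (cactusStep_comm_of_not_exists cs hφ h'.symm hP).symm
    · rw [cactusStep_conj_of_not_exists cs φ x hP, cactusStep_conj_of_not_exists cs φ x hQ,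
        cactusStep_conj_of_not_exists cs φ x hP]

theorem exists_cactusAction : ∃ α : BigGroup cs →* Equiv.Perm (CactusGroup cs),
    ∀ P x, α (tau cs P) x = cactusStep cs φ P x := by
  have hlift : (bigMatrix cs).IsLiftable fun P => (cactusStep_involutive cs hφ P).toPerm := by
    intro P Q
    obtain rfl | ⟨h2, h⟩ | h0 := bigMatrix_cases cs P Q
    · rw [(bigMatrix cs).diagonal, pow_one]
      ext x : 1
      exact cactusStep_involutive cs hφ P x
    · rw [h2]
      ext x : 1
      change cactusStep cs φ P (cactusStep cs φ Q (cactusStep cs φ P (cactusStep cs φ Q x))) = x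
      rw [cactusStep_comm cs hφ h (cactusStep cs φ Q x), cactusStep_involutive cs hφ Q,
        cactusStep_involutive cs hφ P]
    · rw [h0, pow_zero]
  refine ⟨(bigMatrix cs).toCoxeterSystem.lift ⟨_, hlift⟩, fun P x => ?_⟩
  exact congrArg (fun e : Equiv.Perm (CactusGroup cs) => e x)
    ((bigMatrix cs).toCoxeterSystem.lift_apply_simple hlift P)

end Step

/-- The image `τ_{W_I} g_I` of `γ_I` in the semidirect product. -/
def cactusImage (I : ConnectedFamily cs) : BigSemidirect cs :=
  SemidirectProduct.inl (tau cs (.std cs I)) *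
    SemidirectProduct.inr (conjDiagram cs (longest cs I))

theorem mul_cactusImage (u : BigGroup cs) (w : W) (I : ConnectedFamily cs) :
    (SemidirectProduct.inl u * SemidirectProduct.inr (conjDiagram cs w)) * cactusImage cs I =
      (SemidirectProduct.inl (u * tau cs (ParabolicConj.conj cs w (.std cs I))) *
        SemidirectProduct.inr (conjDiagram cs (w * longest cs I)) : BigSemidirect cs) := by
  have h : (SemidirectProduct.inr (conjDiagram cs w) *
      SemidirectProduct.inl (tau cs (.std cs I)) : BigSemidirect cs) =
      SemidirectProduct.inl (tau cs (ParabolicConj.conj cs w (.std cs I))) *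
        SemidirectProduct.inr (conjDiagram cs w) := by
    rw [← conjAut_tau, ← mul_inv_eq_iff_eq_mul, ← map_inv]
    exact (SemidirectProduct.inl_aut (φ := (DiagramAut cs).subtype) (conjDiagram cs w)
      (tau cs (.std cs I))).symm
  rw [cactusImage, mul_assoc, ← mul_assoc (SemidirectProduct.inr (conjDiagram cs w)), h,
    map_mul, map_mul, map_mul]
  simp only [mul_assoc]

theorem cactusImage_mul (I J : ConnectedFamily cs) :
    cactusImage cs I * cactusImage cs J =
      SemidirectProduct.inl (tau cs (.std cs I) *
          tau cs (ParabolicConj.conj cs (longest cs I) (.std cs J))) *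
        SemidirectProduct.inr (conjDiagram cs (longest cs I * longest cs J)) :=
  mul_cactusImage cs _ _ J

theorem cactusImage_mul_self (I : ConnectedFamily cs) :
    cactusImage cs I * cactusImage cs I = 1 := by
  rw [cactusImage_mul, conj_eq_self_of_mem cs (P := .std cs I) (longest_mem cs I), tau_mul_self,
    longest_mul_self, map_one, map_one, map_one, one_mul]

/-- The `𝕎`-parts are `τ_I τ_J` and `τ_J τ_I`, since `w_J` carries `W_K` back to `W_I`;
orthogonality makes them equal. -/
theorem cactusImage_mul_eq {I J K : ConnectedFamily cs} (h : Compatible cs I J)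
    (hK : IsConjBy cs J I K) :
    cactusImage cs I * cactusImage cs J = cactusImage cs J * cactusImage cs K := by
  rw [cactusImage_mul, cactusImage_mul, h.conj_longest cs, ← hK.conj_std cs, ← ParabolicConj.conj_mul,
    longest_mul_self, ParabolicConj.conj_one, hK.longest_mul cs h, (h.orthogonal cs).commute_tau.eq]

/-! ### Recovering an element from its component in the right-angled group. -/

section Injectivity

variable {φ : CactusGroup cs →* W} (hφ : ∀ I, φ (gam cs I) = longest cs I)
  {η : CactusGroup cs →* BigSemidirect cs} (hη : ∀ I, η (gam cs I) = cactusImage cs I)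
include hφ hη

theorem eq_inl_left_mul_inr (x : CactusGroup cs) :
    η x = SemidirectProduct.inl (η x).left * SemidirectProduct.inr (conjDiagram cs (φ x)) := by
  have h : SemidirectProduct.rightHom.comp η = (conjDiagram cs).comp φ := by
    apply PresentedGroup.ext
    intro I
    change SemidirectProduct.rightHom (η (gam cs I)) = conjDiagram cs (φ (gam cs I))
    rw [hη, hφ, cactusImage, map_mul, SemidirectProduct.rightHom_inl,
      SemidirectProduct.rightHom_inr, one_mul]
  have := DFunLike.congr_fun h x
  conv_lhs => rw [← SemidirectProduct.inl_left_mul_inr_right (η x)]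
  congr 2

theorem left_mul_gam (x : CactusGroup cs) (I : ConnectedFamily cs) :
    (η (x * gam cs I)).left =
      (η x).left * tau cs (ParabolicConj.conj cs (φ x) (.std cs I)) := by
  rw [map_mul, hη, eq_inl_left_mul_inr cs hφ hη x, mul_cactusImage]
  simp

/-- The first component of the homomorphism is already injective. -/
theorem left_injective : Function.Injective fun x => (η x).left := by
  obtain ⟨α, hα⟩ := exists_cactusAction cs hφ
  -- The component grows on the right along a word; inverting it makes the newest `τ_P` act last, at
  -- the point `x` already reached.
  have key (x : CactusGroup cs) : α (η x).left⁻¹ 1 = x := by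
    induction x using cactus_induction with
    | one => simp
    | mul_gam x I ih =>
      rw [left_mul_gam cs hφ hη, mul_inv_rev, map_mul, Equiv.Perm.mul_apply, ih,
        inv_eq_of_mul_eq_one_right (tau_mul_self cs _), hα, cactusStep_conj_std]
  intro x y hxy
  rw [← key x, ← key y]
  exact congrArg (fun u => α u⁻¹ 1) hxy

end Injectivity

end Cactus

end GenCactus

end

theorem mainTheorem2 {B : Type*} {W : Type*} [Group W] {M : CoxeterMatrix B}
    (cs : CoxeterSystem M W) :
    -- the set `w_J(I)` in the defining relations of `C_W` is a well-defined member of `F(S)`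
    (∀ I J : GenCactus.ConnectedFamily cs, GenCactus.Compatible cs I J →
      ∃! K : GenCactus.ConnectedFamily cs, GenCactus.IsConjBy cs J I K) ∧
    -- `gW` is the homomorphism `C_W → W` and `h` is the one of the theorem
    ∃ (gW : GenCactus.CactusGroup cs →* W)
      (h : GenCactus.CactusGroup cs →* GenCactus.BigSemidirect cs),
      (∀ I, gW (GenCactus.gam cs I) = GenCactus.longest cs I) ∧
      (∀ I, h (GenCactus.gam cs I) =
        SemidirectProduct.inl (GenCactus.tau cs (GenCactus.ParabolicConj.std cs I)) *
          SemidirectProduct.inr (GenCactus.conjDiagram cs (GenCactus.longest cs I))) ∧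
      Function.Injective h ∧
      SemidirectProduct.rightHom.comp h = (GenCactus.conjDiagram cs).comp gW ∧
      ∃ f : gW.ker →* GenCactus.BigGroup cs,
        Function.Injective f ∧ ∀ x : gW.ker, SemidirectProduct.inl (f x) = h x := by
  refine ⟨fun I J hIJ => ?_, ?_⟩
  · obtain ⟨K, hK⟩ := hIJ.exists_isConjBy cs
    exact ⟨K, hK, fun K' hK' => hK'.unique cs hK⟩
  obtain ⟨φ, hφ⟩ := GenCactus.exists_cactus_lift cs (GenCactus.longest cs)
    (GenCactus.longest_mul_self cs) fun I J K hIJ hK => hK.longest_mul cs hIJ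
  obtain ⟨η, hη⟩ := GenCactus.exists_cactus_lift cs (GenCactus.cactusImage cs)
    (GenCactus.cactusImage_mul_self cs) fun I J K hIJ hK =>
      GenCactus.cactusImage_mul_eq cs hIJ hK
  have hinj := GenCactus.left_injective cs hφ hη
  have hker (x : φ.ker) : SemidirectProduct.inl (η x).left = η x := by
    conv_rhs => rw [GenCactus.eq_inl_left_mul_inr cs hφ hη x]
    rw [MonoidHom.mem_ker.1 x.2, map_one, map_one, mul_one]
  refine ⟨φ, η, hφ, hη, fun x y hxy => hinj (congrArg SemidirectProduct.left hxy), ?_, ?_⟩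
  · refine MonoidHom.ext fun x => ?_
    rw [MonoidHom.comp_apply, GenCactus.eq_inl_left_mul_inr cs hφ hη x]
    simp
  · refine ⟨⟨⟨fun x => (η x).left, by simp⟩, fun x y => ?_⟩, fun x y hxy => ?_, hker⟩
    -- The left component is only a crossed homomorphism in general; on the kernel `η` takes values
    -- in the image of `inl`, so it is multiplicative there.
    · apply SemidirectProduct.inl_injective (φ := (GenCactus.DiagramAut cs).subtype)
      rw [map_mul]
      exact (hker (x * y)).trans ((map_mul η _ _).trans (by rw [hker x, hker y]))
    · exact Subtype.ext (hinj hxy)
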